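/- Formulas are built from countably many propositional variables and $\bot$ by the Boolean connectives and the modalities $[n]$, $n\in\omega$; $\langle n\rangle\varphi$ abbreviates $\neg[n]\neg\varphi$. The logic $\mathbf{GLP}$ has as axioms all Boolean tautologies of this language and all formulas - $[n](\varphi\to\psi)\to([n]\varphi\to[n]\psi)$, - $[n]([n]\varphi\to\varphi)\to[n]\varphi$, - $[m]\varphi\to[n]\varphi$ for $m<n$, - $\langle m\rangle\varphi\to[n]\langle m\rangle\varphi$ for $m<n$, and as rules modus ponens and necessitation ($\varphi\,/\,[n]\varphi$ for each $n\in\omega$). For a topology $\tau$ on a set $X$ and $A\subseteq X$, let $d_\tau(A)$ be the set of limit points of $A$, i.e. of all $x$ such that every open neighborhood of $x$ contains a point $y\ne x$ of $A$. A topology is scattered if every nonempty subspace has an isolated point. A GLP-space is a nonempty set $X$ with topologies $\tau_0,\tau_1,\dots$ such that, for every $n\in\omega$: $\tau_n$ is scattered; $\tau_n\subseteq\tau_{n+1}$; and $d_{\tau_n}(A)$ is $\tau_{n+1}$-open for every $A\subseteq X$. A valuation $v$ assigns a subset of $X$ to each variable and extends to all formulas by interpreting the Boolean connectives as the set operations and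 putting $v([n]\varphi)=X\setminus d_{\tau_n}(X\setminus v(\varphi))$, so that $v(\langle n\rangle\varphi)=d_{\tau_n}(v(\varphi))$. A formula $\varphi$ is valid in the GLP-space if $v(\varphi)=X$ for every valuation $v$; otherwise it is refuted on it. Theorem (topological completeness of $\mathbf{GLP}$). Every formula that is not provable in $\mathbf{GLP}$ is refuted on some GLP-space. Moreover, $\mathbf{GLP}$ is the logic of the class of all GLP-spaces: a formula is provable in $\mathbf{GLP}$ if and only if it is valid in every GLP-space. -/

import Mathlib

universe u

namespace GLP

/-- Formulas of the modal language with modalities `[0], [1], [2], …` over countably many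
propositional variables. -/
inductive Formula : Type where
  | var : ℕ → Formula
  | bot : Formula
  | imp : Formula → Formula → Formula
  | box : ℕ → Formula → Formula

namespace Formula

def neg (φ : Formula) : Formula := imp φ bot

def or (φ ψ : Formula) : Formula := imp (neg φ) ψ

def and (φ ψ : Formula) : Formula := neg (imp φ (neg ψ))

/-- `⟨n⟩φ` is `¬[n]¬φ`. -/
def dia (n : ℕ) (φ : Formula) : Formula := neg (box n (neg φ))

/-- Propositional truth under an assignment `e` of truth values to the variables and to the
formulas `[n]φ`, which count as atoms here. -/
def propTruth (e : Formula → Prop) : Formula → Prop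
  | var p => e (var p)
  | bot => False
  | imp φ ψ => propTruth e φ → propTruth e ψ
  | box n φ => e (box n φ)

/-- Boolean tautologies of the modal language. -/
def IsTautology (φ : Formula) : Prop := ∀ e : Formula → Prop, propTruth e φ

end Formula

open Formula
open scoped Topology

/-- `Provable φ` is `GLP ⊢ φ`. -/
inductive Provable : Formula → Prop where
  | taut (φ : Formula) : IsTautology φ → Provable φ
  | distrib (n : ℕ) (φ ψ : Formula) :
      Provable (imp (box n (imp φ ψ)) (imp (box n φ) (box n ψ)))
  | loeb (n : ℕ) (φ : Formula) : Provable (imp (box n (imp (box n φ) φ)) (box n φ))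
  | mono (m n : ℕ) (φ : Formula) : m < n → Provable (imp (box m φ) (box n φ))
  | negIntro (m n : ℕ) (φ : Formula) : m < n → Provable (imp (dia m φ) (box n (dia m φ)))
  | mp (φ ψ : Formula) : Provable φ → Provable (imp φ ψ) → Provable ψ
  | nec (n : ℕ) (φ : Formula) : Provable φ → Provable (box n φ)

/-- The extension of a valuation `v` to all formulas in the neighborhood frame
`(X, δ 0, δ 1, …)`; `δ n` interprets `⟨n⟩`, and its dual interprets `[n]`. -/
def value {X : Type*} (δ : ℕ → Set X → Set X) (v : ℕ → Set X) : Formula → Set X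
  | var p => v p
  | bot => ∅
  | imp φ ψ => (value δ v φ)ᶜ ∪ value δ v ψ
  | box n φ => (δ n (value δ v φ)ᶜ)ᶜ

theorem value_neg {X : Type*} (δ : ℕ → Set X → Set X) (v : ℕ → Set X) (φ : Formula) :
    value δ v (neg φ) = (value δ v φ)ᶜ := by
  simp [neg, value]

theorem value_or {X : Type*} (δ : ℕ → Set X → Set X) (v : ℕ → Set X) (φ ψ : Formula) :
    value δ v (Formula.or φ ψ) = value δ v φ ∪ value δ v ψ := by
  simp [Formula.or, neg, value]

theorem value_dia {X : Type*} (δ : ℕ → Set X → Set X) (v : ℕ → Set X) (n : ℕ) (φ : Formula) :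
    value δ v (dia n φ) = δ n (value δ v φ) := by
  simp [dia, neg, value]

/-- `φ` is valid in the neighborhood frame `(X, δ 0, δ 1, …)`. -/
def Valid {X : Type*} (δ : ℕ → Set X → Set X) (φ : Formula) : Prop :=
  ∀ v : ℕ → Set X, value δ v φ = Set.univ

/-- Every nonempty subspace has an isolated point. -/
def IsScattered {X : Type*} (τ : TopologicalSpace X) : Prop :=
  ∀ A : Set X, A.Nonempty → ∃ x ∈ A, ∃ U : Set X, IsOpen[τ] U ∧ U ∩ A = {x}

/-- The derived set operators of a sequence of topologies. -/
def derivedOps {X : Type*} (τ : ℕ → TopologicalSpace X) (n : ℕ) (A : Set X) : Set X :=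
  @derivedSet X (τ n) A

/-- `(X, τ 0, τ 1, …)` is a GLP-space. -/
structure IsGLPSpace {X : Type*} (τ : ℕ → TopologicalSpace X) : Prop where
  nonempty : Nonempty X
  scattered : ∀ n, IsScattered (τ n)
  increasing : ∀ n (U : Set X), IsOpen[τ n] U → IsOpen[τ (n + 1)] U
  derived_open : ∀ n (A : Set X), IsOpen[τ (n + 1)] (derivedOps τ n A)

/-- The logic of the class of all GLP-spaces (with carriers in the universe `u`). -/
def logicOfGLPSpaces : Set Formula :=
  {φ | ∀ (X : Type u) (τ : ℕ → TopologicalSpace X), IsGLPSpace τ → Valid (derivedOps τ) φ}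

end GLP

namespace GLP
open Formula
open scoped Topology

/-! ### Maximal consistent sets -/

/-! Soundness is direct: Löb's axiom expresses scatteredness, and `⟨m⟩φ → [n]⟨m⟩φ` expresses
openness of derived sets. For completeness the points are maximal consistent sets, topologized so
that membership is truth.

Scatteredness needs a rank that drops at some witness of each failure of `[0]`. The well-founded
part `Founded` of the canonical model carries one: the least stage. It still refutes every
unprovable formula, because for finite `Δ` closed under subformulas each maximal consistent set has
the same trace on `Δ` as some founded one (`mem_realization_iff`).

The topologies start from initial segments of the rank. At level `n`, `refinement` ensures that a
point containing `[n]ψ` is not a limit of points omitting `ψ`, while `HasLimits` keeps the converse.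
Zorn's lemma then gives a topology maximal with `HasLimits`. Maximality puts around each limit point
of an arbitrary set a relative neighborhood of the form `{y | [n]ψ ∉ th y}` inside the derived set
(`IsLimitMaximal.exists_of_mem_derivedSet`). The refinement at level `n + 1` opens such sets, since
`¬[n]ψ → [n+1]¬[n]ψ`. -/

/-- Derivability from hypotheses, without necessitation of hypotheses. -/
inductive Der (Γ : Set Formula) : Formula → Prop where
  | hyp (φ : Formula) : φ ∈ Γ → Der Γ φ
  | thm (φ : Formula) : Provable φ → Der Γ φ
  | mp (φ ψ : Formula) : Der Γ φ → Der Γ (imp φ ψ) → Der Γ ψ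

theorem Der.mono {Γ Γ' : Set Formula} (h : Γ ⊆ Γ') {φ : Formula} (d : Der Γ φ) : Der Γ' φ := by
  induction d with
  | hyp φ hφ => exact .hyp _ (h hφ)
  | thm φ hφ => exact .thm _ hφ
  | mp φ ψ _ _ ih₁ ih₂ => exact .mp _ _ ih₁ ih₂

theorem Der.taut {Γ : Set Formula} {φ : Formula} (h : IsTautology φ) : Der Γ φ :=
  .thm _ (.taut _ h)

theorem Der.deduction {Γ : Set Formula} {φ ψ : Formula} (d : Der (insert φ Γ) ψ) :
    Der Γ (imp φ ψ) := by
  have weaken : ∀ χ, Der Γ χ → Der Γ (imp φ χ) := fun χ h =>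
    .mp _ _ h (.taut fun e => by simp only [propTruth]; tauto)
  induction d with
  | hyp χ hχ =>
    rcases hχ with rfl | hχ
    · exact .taut fun e => by simp only [propTruth]; tauto
    · exact weaken _ (.hyp _ hχ)
  | thm χ hχ => exact weaken _ (.thm _ hχ)
  | mp χ θ _ _ ih₁ ih₂ =>
    refine .mp _ _ ih₁ (.mp _ _ ih₂ (.taut fun e => ?_))
    simp only [propTruth]; tauto

theorem Der.exists_of_sUnion {c : Set (Set Formula)} (hc : IsChain (· ⊆ ·) c) (hne : c.Nonempty)
    {φ : Formula} (d : Der (⋃₀ c) φ) : ∃ Γ ∈ c, Der Γ φ := by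
  induction d with
  | hyp φ hφ =>
    obtain ⟨Γ, hΓ, h⟩ := hφ
    exact ⟨Γ, hΓ, .hyp _ h⟩
  | thm φ hφ =>
    obtain ⟨Γ, hΓ⟩ := hne
    exact ⟨Γ, hΓ, .thm _ hφ⟩
  | mp φ ψ _ _ ih₁ ih₂ =>
    obtain ⟨Γ₁, h₁, d₁⟩ := ih₁
    obtain ⟨Γ₂, h₂, d₂⟩ := ih₂
    rcases hc.total h₁ h₂ with h | h
    · exact ⟨Γ₂, h₂, .mp _ _ (d₁.mono h) d₂⟩
    · exact ⟨Γ₁, h₁, .mp _ _ d₁ (d₂.mono h)⟩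

theorem Der.provable {φ : Formula} (d : Der ∅ φ) : Provable φ := by
  induction d with
  | hyp φ hφ => exact hφ.elim
  | thm φ hφ => exact hφ
  | mp φ ψ _ _ ih₁ ih₂ => exact .mp _ _ ih₁ ih₂

/-- Maximal `GLP`-consistent sets of formulas. -/
structure IsMax (t : Set Formula) : Prop where
  bot : bot ∉ t
  imp_iff : ∀ φ ψ, imp φ ψ ∈ t ↔ (φ ∈ t → ψ ∈ t)
  thm : ∀ φ, Provable φ → φ ∈ t

theorem exists_isMax {Γ : Set Formula} {φ : Formula} (h : ¬ Der Γ φ) :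
    ∃ t, IsMax t ∧ Γ ⊆ t ∧ φ ∉ t := by
  obtain ⟨m, hΓm, hm⟩ := zorn_subset_nonempty {Δ | ¬ Der Δ φ} (fun c hcS hc hne =>
    ⟨⋃₀ c, fun d => by
      obtain ⟨Δ, hΔ, d⟩ := d.exists_of_sUnion hc hne
      exact hcS hΔ d, fun s hs => Set.subset_sUnion_of_mem hs⟩) Γ h
  have hmφ : ¬ Der m φ := hm.prop
  have ext : ∀ ψ, ψ ∉ m → Der m (imp ψ φ) := fun ψ hψ => by
    by_contra hd
    exact hψ (hm.le_of_ge (y := insert ψ m) (fun d => hd d.deduction) (Set.subset_insert _ _)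
      (Set.mem_insert _ _))
  have closed : ∀ ψ, Der m ψ → ψ ∈ m := fun ψ d => by
    by_contra hψ
    exact hmφ (.mp _ _ d (ext ψ hψ))
  refine ⟨m, ⟨fun hb => ?_, fun a b => ⟨fun hab ha => ?_, fun hab => ?_⟩,
    fun ψ hψ => closed _ (.thm _ hψ)⟩, hΓm, fun hφ => hmφ (.hyp _ hφ)⟩
  · exact hmφ (.mp _ _ (.hyp _ hb) (.taut fun e => by simp [propTruth]))
  · exact closed _ (.mp _ _ (.hyp _ ha) (.hyp _ hab))
  · by_cases ha : a ∈ m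
    · exact closed _ (.mp _ _ (.hyp _ (hab ha)) (.taut fun e => by simp only [propTruth]; tauto))
    · by_contra hn
      -- Both `a` and `a → b` imply `φ` over `m`, and one of the two is always true.
      refine hmφ (.mp _ _ (ext _ hn) (.mp _ _ (ext _ ha) (.taut fun e => ?_)))
      simp only [propTruth]; tauto

theorem provable_of_forall_isMax {φ : Formula} (h : ∀ t, IsMax t → φ ∈ t) : Provable φ := by
  refine Der.provable ?_
  by_contra hd
  obtain ⟨t, ht, -, hφ⟩ := exists_isMax hd
  exact hφ (h t ht)

namespace IsMax

theorem neg_iff {t : Set Formula} (ht : IsMax t) (φ : Formula) : neg φ ∈ t ↔ φ ∉ t := by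
  simp only [neg, ht.imp_iff, ht.bot, imp_false]

theorem and_iff {t : Set Formula} (ht : IsMax t) (φ ψ : Formula) : Formula.and φ ψ ∈ t ↔ φ ∈ t ∧ ψ ∈ t := by
  simp only [Formula.and, ht.neg_iff, ht.imp_iff]; tauto

theorem mp_thm {t : Set Formula} (ht : IsMax t) {φ ψ : Formula} (h : Provable (imp φ ψ)) (hφ : φ ∈ t) : ψ ∈ t :=
  (ht.imp_iff _ _).1 (ht.thm _ h) hφ

theorem box_mp {t : Set Formula} (ht : IsMax t) {n : ℕ} {φ ψ : Formula} (h : box n (imp φ ψ) ∈ t) (hφ : box n φ ∈ t) :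
    box n ψ ∈ t :=
  (ht.imp_iff _ _).1 (ht.mp_thm (.distrib n φ ψ) h) hφ

theorem box_of_entails {t : Set Formula} (ht : IsMax t) {n : ℕ} {φ ψ : Formula} (h : ∀ s, IsMax s → φ ∈ s → ψ ∈ s)
    (hφ : box n φ ∈ t) : box n ψ ∈ t :=
  ht.box_mp (ht.thm _ (.nec n _ (provable_of_forall_isMax fun s hs => (hs.imp_iff _ _).2 (h s hs))))
    hφ

theorem box_mono {t : Set Formula} (ht : IsMax t) {m n : ℕ} (hmn : m ≤ n) {φ : Formula} (hφ : box m φ ∈ t) : box n φ ∈ t := by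
  rcases hmn.eq_or_lt with rfl | hmn
  · exact hφ
  · exact ht.mp_thm (.mono m n φ hmn) hφ

theorem box_loeb {t : Set Formula} (ht : IsMax t) {n : ℕ} {φ : Formula} (h : box n (imp (box n φ) φ) ∈ t) : box n φ ∈ t :=
  ht.mp_thm (.loeb n φ) h

theorem box_box {t : Set Formula} (ht : IsMax t) {n : ℕ} {φ : Formula} (h : box n φ ∈ t) : box n (box n φ) ∈ t := by
  -- Transitivity comes from Löb's axiom for `φ ∧ [n]φ`.
  have : box n (Formula.and φ (box n φ)) ∈ t := by
    refine ht.box_loeb (ht.box_of_entails (fun s hs hφ => ?_) h)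
    refine (hs.imp_iff _ _).2 fun hb => (hs.and_iff _ _).2 ⟨hφ, ?_⟩
    exact hs.box_of_entails (fun r hr hr' => ((hr.and_iff _ _).1 hr').1) hb
  exact ht.box_of_entails (fun s hs hs' => ((hs.and_iff _ _).1 hs').2) this

theorem box_box_of_le {t : Set Formula} (ht : IsMax t) {m n : ℕ} (hmn : m ≤ n) {φ : Formula} (h : box m φ ∈ t) :
    box n (box m φ) ∈ t :=
  ht.box_mono hmn (ht.box_box h)

theorem box_neg_box {t : Set Formula} (ht : IsMax t) {m n : ℕ} (hmn : m < n) {φ : Formula} (h : box m φ ∉ t) :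
    box n (neg (box m φ)) ∈ t := by
  have nn : ∀ s, IsMax s → (box m (neg (neg φ)) ∈ s ↔ box m φ ∈ s) := fun s hs =>
    ⟨hs.box_of_entails fun r hr => by simp [hr.neg_iff],
      hs.box_of_entails fun r hr => by simp [hr.neg_iff]⟩
  refine ht.box_of_entails (fun s hs hs' => ?_)
    (ht.mp_thm (.negIntro m n (neg φ) hmn) ?_)
  · rw [hs.neg_iff, ← nn s hs, ← hs.neg_iff]; exact hs'
  · rw [dia, ht.neg_iff, nn t ht]; exact h

theorem box_of_der {t : Set Formula} (ht : IsMax t) {n : ℕ} {φ : Formula} (d : Der {χ | box n χ ∈ t} φ) : box n φ ∈ t := by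
  induction d with
  | hyp φ hφ => exact hφ
  | thm φ hφ => exact ht.thm _ (.nec n _ hφ)
  | mp φ ψ _ _ ih₁ ih₂ => exact ht.box_mp ih₂ ih₁

end IsMax

/-- The canonical accessibility relation for the modality `[j]`. -/
def Rel (j : ℕ) (t s : Set Formula) : Prop :=
  (∀ ψ, box j ψ ∈ t → ψ ∈ s ∧ box j ψ ∈ s) ∧ ∀ i < j, ∀ ψ, box i ψ ∈ t ↔ box i ψ ∈ s

/-- By Löb's axiom the witness can be made to contain `[j]ψ` itself; this gain drives the induction
in `mem_realization_iff`. -/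
theorem IsMax.exists_rel {w : Set Formula} (hw : IsMax w) {j : ℕ} {ψ : Formula}
    (h : box j ψ ∉ w) : ∃ u, IsMax u ∧ Rel j w u ∧ ψ ∉ u ∧ box j ψ ∈ u := by
  have hd : ¬ Der (insert (box j ψ) {χ | box j χ ∈ w}) ψ := fun d =>
    h (hw.box_loeb (hw.box_of_der d.deduction))
  obtain ⟨u, hu, hsub, hψ⟩ := exists_isMax hd
  have key : ∀ χ, box j χ ∈ w → χ ∈ u := fun χ hχ => hsub (Set.mem_insert_of_mem _ hχ)
  refine ⟨u, hu, ⟨fun χ hχ => ⟨key _ hχ, key _ (hw.box_box hχ)⟩, fun i hi χ => ⟨fun hχ => ?_,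
    fun hχ => ?_⟩⟩, hψ, hsub (Set.mem_insert _ _)⟩
  · exact key _ (hw.box_box_of_le hi.le hχ)
  · by_contra hn
    exact (hu.neg_iff _).1 (key _ (hw.box_neg_box hi hn)) hχ

/-! ### The well-founded part of the canonical model -/

/-- The `α`-th stage of the well-founded part of the canonical model. -/
def Stage (α : Ordinal.{0}) : Set (Set Formula) :=
  {t | IsMax t ∧ ∀ j ψ, box j ψ ∉ t →
    ∃ β, ∃ _ : β < α, ∃ s, s ∈ Stage β ∧ Rel j t s ∧ ψ ∉ s}
termination_by α

theorem mem_stage {α : Ordinal.{0}} {t : Set Formula} : t ∈ Stage α ↔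
    IsMax t ∧ ∀ j ψ, box j ψ ∉ t → ∃ β < α, ∃ s ∈ Stage β, Rel j t s ∧ ψ ∉ s := by
  rw [Stage]
  simp only [Set.mem_ofPred_eq, exists_prop]

/-- The well-founded part of the canonical model. -/
def Founded : Set (Set Formula) := {t | ∃ α, t ∈ Stage α}

theorem Founded.isMax {t : Set Formula} (h : t ∈ Founded) : IsMax t :=
  h.elim fun _ h => (mem_stage.1 h).1

theorem Founded.exists_rel {t : Set Formula} (h : t ∈ Founded) {j : ℕ} {ψ : Formula}
    (hψ : box j ψ ∉ t) : ∃ s ∈ Founded, Rel j t s ∧ ψ ∉ s := by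
  obtain ⟨α, h⟩ := h
  obtain ⟨β, -, s, hs, hr⟩ := (mem_stage.1 h).2 j ψ hψ
  exact ⟨s, ⟨β, hs⟩, hr⟩

theorem IsMax.mem_founded {t : Set Formula} (ht : IsMax t)
    (h : ∀ j ψ, box j ψ ∉ t → ∃ s ∈ Founded, Rel j t s ∧ ψ ∉ s) : t ∈ Founded := by
  choose s hs hr hψ using h
  choose β hβ using hs
  -- The pairs form a small type, so the stages of the chosen witnesses have a supremum.
  let f : {p : ℕ × Formula // box p.1 p.2 ∉ t} → Ordinal.{0} := fun p => β p.1.1 p.1.2 p.2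
  refine ⟨Order.succ (iSup f), mem_stage.2 ⟨ht, fun j ψ hj => ⟨β j ψ hj, ?_, s j ψ hj, hβ j ψ hj,
    hr j ψ hj, hψ j ψ hj⟩⟩⟩
  exact Order.lt_succ_iff.2 (Ordinal.le_iSup f ⟨(j, ψ), hj⟩)

/-! ### Realizing finite types in the well-founded part -/

section Realize

variable (Δ : Set Formula)

/-- Compatibility of `u` with the formulas `[i]ψ ∈ Δ`, `i ≤ j`, that hold in `w`. -/
def Compat (w : Set Formula) (j : ℕ) (u : Set Formula) : Prop :=
  (∀ i ≤ j, ∀ ψ, box i ψ ∈ Δ → box i ψ ∈ w → ψ ∈ u ∧ box i ψ ∈ u) ∧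
    ∀ i < j, ∀ ψ, box i ψ ∈ Δ → box i ψ ∈ u → box i ψ ∈ w

/-- The founded theories to be seen along `[j]` from the theory realizing `w ∩ Δ`. -/
def successors (w : Set Formula) (j : ℕ) : Set (Set Formula) :=
  {s | s ∈ Founded ∧ Compat Δ w j s ∧
    ∀ i, ∀ _ : i < j, ∀ ψ, box i ψ ∈ s ↔ ∀ r, r ∈ successors w i → ψ ∈ r}
termination_by j

variable {Δ}

theorem mem_successors {w s : Set Formula} {j : ℕ} : s ∈ successors Δ w j ↔
    s ∈ Founded ∧ Compat Δ w j s ∧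
      ∀ i < j, ∀ ψ, box i ψ ∈ s ↔ ∀ r ∈ successors Δ w i, ψ ∈ r := by
  rw [successors]
  simp only [Set.mem_ofPred_eq]

theorem compat_congr {w u : Set Formula} {j : ℕ}
    (h : ∀ i ≤ j, ∀ ψ, box i ψ ∈ Δ → (box i ψ ∈ w ↔ box i ψ ∈ u)) (s : Set Formula) :
    Compat Δ w j s ↔ Compat Δ u j s := by
  unfold Compat
  refine and_congr (forall₂_congr fun i hi => forall₂_congr fun ψ hψ => ?_)
    (forall₂_congr fun i hi => forall₂_congr fun ψ hψ => ?_)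
  · rw [h i hi ψ hψ]
  · rw [h i hi.le ψ hψ]

/-- Level `j` of the recursion consults only levels below `j`. Hence a `Rel j`-witness `u` for `w`
has the same successors as `w` at every level below `j`. -/
theorem successors_congr {w u : Set Formula} {j : ℕ}
    (h : ∀ i ≤ j, ∀ ψ, box i ψ ∈ Δ → (box i ψ ∈ w ↔ box i ψ ∈ u)) :
    successors Δ w j = successors Δ u j := by
  induction j using Nat.strong_induction_on with
  | _ j ih =>
    ext s
    rw [mem_successors, mem_successors, compat_congr h]
    refine and_congr_right fun _ => and_congr_right fun _ =>
      forall₂_congr fun i hi => forall_congr' fun ψ => ?_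
    rw [ih i hi fun k hk => h k (hk.trans hi.le)]

theorem Compat.mono {w u : Set Formula} {i j : ℕ} (hij : i ≤ j) (h : Compat Δ w j u) :
    Compat Δ w i u :=
  ⟨fun k hk => h.1 k (hk.trans hij), fun k hk => h.2 k (hk.trans_le hij)⟩

theorem successors_anti (w : Set Formula) {i j : ℕ} (hij : i ≤ j) :
    successors Δ w j ⊆ successors Δ w i := fun s hs => by
  rw [mem_successors] at hs ⊢
  exact ⟨hs.1, hs.2.1.mono hij, fun k hk => hs.2.2 k (hk.trans_le hij)⟩

variable (Δ) in
/-- Truth at the point with the variables of `w` that sees `successors Δ w j` along `[j]`. -/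
def realizes (w : Set Formula) : Formula → Prop
  | var p => var p ∈ w
  | bot => False
  | imp φ ψ => realizes w φ → realizes w ψ
  | box j ψ => ∀ s ∈ successors Δ w j, ψ ∈ s

variable (Δ) in
/-- The theory realizing `w ∩ Δ` in the well-founded part. -/
def realization (w : Set Formula) : Set Formula := {ψ | realizes Δ w ψ}

theorem box_mem_realization {w : Set Formula} {j : ℕ} {ψ : Formula} :
    box j ψ ∈ realization Δ w ↔ ∀ s ∈ successors Δ w j, ψ ∈ s := Iff.rfl

theorem imp_mem_realization {w : Set Formula} {φ ψ : Formula} :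
    imp φ ψ ∈ realization Δ w ↔ (φ ∈ realization Δ w → ψ ∈ realization Δ w) := Iff.rfl

theorem successors_trans {w s r : Set Formula} {j : ℕ}
    (hs : s ∈ successors Δ w j) (hr : r ∈ Founded) (hsr : Rel j s r) :
    r ∈ successors Δ w j := by
  rw [mem_successors] at hs ⊢
  obtain ⟨hs, hc, he⟩ := hs
  refine ⟨hr, ⟨fun i hi ψ hψ hw => ?_, fun i hi ψ hψ hw => ?_⟩, fun i hi ψ => ?_⟩
  · have h := hc.1 i hi ψ hψ hw
    refine ⟨(hsr.1 _ ((Founded.isMax hs).box_mono hi h.2)).1, ?_⟩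
    rcases hi.eq_or_lt with rfl | hi
    · exact (hsr.1 _ h.2).2
    · exact (hsr.2 i hi ψ).1 h.2
  · exact hc.2 i hi ψ hψ ((hsr.2 i hi ψ).2 hw)
  · rw [← hsr.2 i hi, he i hi]

/-- The last clause of `successors` concerns all formulas, not only those in `Δ`, so it gives full
agreement on lower boxes. Boxes `[j]ψ` persist because founded `Rel j`-successors of `s` are again
successors of `w`. -/
theorem rel_realization {w s : Set Formula} {j : ℕ} (hs : s ∈ successors Δ w j) :
    Rel j (realization Δ w) s := by
  have hs' := mem_successors.1 hs
  refine ⟨fun ψ h => ⟨h s hs, ?_⟩, fun i hi ψ => ((hs'.2.2 i hi ψ).trans box_mem_realization).symm⟩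
  by_contra hn
  obtain ⟨r, hr, hsr, hψ⟩ := Founded.exists_rel hs'.1 hn
  exact hψ (h r (successors_trans hs hr hsr))

theorem propTruth_realization (w : Set Formula) (φ : Formula) :
    propTruth (· ∈ realization Δ w) φ ↔ φ ∈ realization Δ w := by
  induction φ with
  | var p => rfl
  | bot => rfl
  | imp φ ψ ih₁ ih₂ => rw [imp_mem_realization, ← ih₁, ← ih₂]; rfl
  | box n φ => rfl

/-- A soundness check at a new root placed over founded theories; the axioms hold at the root
because they hold at its successors and the two are linked by `Rel`. -/
theorem isMax_realization (w : Set Formula) : IsMax (realization Δ w) := by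
  refine ⟨id, fun _ _ => Iff.rfl, fun φ hφ => ?_⟩
  have succMax : ∀ {j s}, s ∈ successors Δ w j → IsMax s := fun hs =>
    Founded.isMax (mem_successors.1 hs).1
  induction hφ with
  | taut φ h => exact (propTruth_realization w φ).1 (h _)
  | distrib n φ ψ =>
    intro h₁ h₂ s hs
    exact ((succMax hs).imp_iff _ _).1 (h₁ s hs) (h₂ s hs)
  | loeb n φ =>
    intro h s hs
    have hm := succMax hs
    have hb := ((rel_realization hs).1 _ h)
    exact (hm.imp_iff _ _).1 hb.1 (hm.box_loeb hb.2)
  | mono m n φ hmn => exact fun h s hs => h s (successors_anti w hmn.le hs)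
  | negIntro m n φ hmn =>
    intro h s hs
    rw [dia, (succMax hs).neg_iff, ← (rel_realization hs).2 m hmn]
    exact h
  | mp φ ψ _ _ ih₁ ih₂ => exact ih₂ ih₁
  | nec n φ h _ => exact fun s hs => (succMax hs).thm _ h

theorem realization_mem_founded (w : Set Formula) : realization Δ w ∈ Founded := by
  refine (isMax_realization w).mem_founded fun j ψ h => ?_
  rw [box_mem_realization] at h
  push Not at h
  obtain ⟨s, hs, hψ⟩ := h
  exact ⟨s, (mem_successors.1 hs).1, rel_realization hs, hψ⟩

/-- Lexicographic growth of the sets of formulas `[0]ψ, [1]ψ, …` in `Δ`. -/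
def BoxLT (a b : Set Δ) : Prop :=
  ∃ j, (∀ i < j, ∀ ψ, ∀ h : box i ψ ∈ Δ, ⟨_, h⟩ ∈ a ↔ ⟨_, h⟩ ∈ b) ∧
    (∀ ψ, ∀ h : box j ψ ∈ Δ, ⟨_, h⟩ ∈ b → ⟨_, h⟩ ∈ a) ∧
    ∃ ψ, ∃ h : box j ψ ∈ Δ, ⟨_, h⟩ ∈ a ∧ ⟨_, h⟩ ∉ b

theorem boxLT_wf (hfin : Δ.Finite) : WellFounded (BoxLT (Δ := Δ)) := by
  have := hfin.to_subtype
  have : Std.Irrefl (BoxLT (Δ := Δ)) := ⟨fun a ⟨j, _, _, ψ, h, h₁, h₂⟩ => h₂ h₁⟩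
  have : IsTrans _ (BoxLT (Δ := Δ)) := ⟨by
    rintro a b c ⟨j, ha₁, ha₂, ψ, hψ, hψa, hψb⟩ ⟨k, hb₁, hb₂, χ, hχ, hχb, hχc⟩
    rcases lt_trichotomy j k with hjk | rfl | hjk
    · exact ⟨j, fun i hi θ h => (ha₁ i hi θ h).trans (hb₁ i (hi.trans hjk) θ h),
        fun θ h hc => ha₂ θ h ((hb₁ j hjk θ h).2 hc), ψ, hψ, hψa,
        fun hc => hψb ((hb₁ j hjk ψ hψ).2 hc)⟩
    · exact ⟨j, fun i hi θ h => (ha₁ i hi θ h).trans (hb₁ i hi θ h),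
        fun θ h hc => ha₂ θ h (hb₂ θ h hc), ψ, hψ, hψa, fun hc => hψb (hb₂ ψ hψ hc)⟩
    · exact ⟨k, fun i hi θ h => (ha₁ i (hi.trans hjk) θ h).trans (hb₁ i hi θ h),
        fun θ h hc => (ha₁ k hjk θ h).2 (hb₂ θ h hc), χ, hχ, (ha₁ k hjk χ hχ).2 hχb, hχc⟩⟩
  exact Finite.wellFounded_of_trans_of_irrefl _

theorem mem_realization_iff (hΔbox : ∀ i ψ, box i ψ ∈ Δ → ψ ∈ Δ) (hfin : Δ.Finite)
    (hΔimp : ∀ φ ψ, imp φ ψ ∈ Δ → φ ∈ Δ ∧ ψ ∈ Δ) {w : Set Formula} (hw : IsMax w)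
    {φ : Formula} (hφ : φ ∈ Δ) : φ ∈ realization Δ w ↔ φ ∈ w := by
  let trace : Set Formula → Set Δ := fun w => {x | x.1 ∈ w}
  induction w using (InvImage.wf trace (boxLT_wf hfin)).induction generalizing φ with
  | _ w ih =>
  induction φ with
  | var p => exact Iff.rfl
  | bot => exact ⟨False.elim, hw.bot⟩
  | imp φ ψ ih₁ ih₂ =>
    have h₁ : φ ∈ realization Δ w ↔ φ ∈ w := ih₁ (hΔimp _ _ hφ).1
    have h₂ : ψ ∈ realization Δ w ↔ ψ ∈ w := ih₂ (hΔimp _ _ hφ).2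
    rw [imp_mem_realization, hw.imp_iff, h₁, h₂]
  | box j ψ _ =>
    refine ⟨fun h => ?_, fun h s hs => ((mem_successors.1 hs).2.1.1 j le_rfl ψ hφ h).1⟩
    by_contra hn
    -- The witness `u` keeps the boxes below `j` and gains `[j]ψ`, so it precedes `w` in `BoxLT` and
    -- its realization agrees with it on `Δ`. That realization is a successor of `w` omitting `ψ`.
    obtain ⟨u, hu, hr, hψ, hb⟩ := hw.exists_rel hn
    have ihu : ∀ {χ}, χ ∈ Δ → (χ ∈ realization Δ u ↔ χ ∈ u) := fun hχ =>
      ih u ⟨j, fun i hi χ _ => (hr.2 i hi χ).symm, fun χ _ hχ => (hr.1 χ hχ).2, ψ, hφ, hb, hn⟩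
        hu hχ
    refine hψ ((ihu (hΔbox _ _ hφ)).1 (h _ (mem_successors.2 ⟨realization_mem_founded u,
      ⟨fun i hi χ hχ hw' => ?_, fun i hi χ hχ hu' => (hr.2 i hi χ).2 ((ihu hχ).1 hu')⟩,
      fun i hi χ => ?_⟩)))
    · rw [ihu hχ, ihu (hΔbox _ _ hχ)]
      refine ⟨(hr.1 _ (hw.box_mono hi hw')).1, ?_⟩
      rcases hi.eq_or_lt with rfl | hi
      · exact (hr.1 _ hw').2
      · exact (hr.2 i hi χ).1 hw'
    · rw [box_mem_realization, successors_congr (w := u) (u := w)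
        fun k hk θ _ => (hr.2 k (hk.trans_lt hi) θ).symm]

end Realize

/-- The set of subformulas. -/
def subformulas : Formula → Set Formula
  | var p => {var p}
  | bot => {bot}
  | imp φ ψ => insert (imp φ ψ) (subformulas φ ∪ subformulas ψ)
  | box n φ => insert (box n φ) (subformulas φ)

theorem self_mem_subformulas (φ : Formula) : φ ∈ subformulas φ := by
  cases φ <;> simp [subformulas]

theorem subformulas_finite (φ : Formula) : (subformulas φ).Finite := by
  induction φ with
  | var p => exact Set.finite_singleton _
  | bot => exact Set.finite_singleton _
  | imp φ ψ ih₁ ih₂ => exact (ih₁.union ih₂).insert _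
  | box n φ ih => exact ih.insert _

theorem subformulas_subset {φ χ : Formula} (h : χ ∈ subformulas φ) :
    subformulas χ ⊆ subformulas φ := by
  induction φ with
  | var p => rw [Set.mem_singleton_iff.1 h]
  | bot => rw [Set.mem_singleton_iff.1 h]
  | imp φ ψ ih₁ ih₂ =>
    rcases h with rfl | h | h
    · exact subset_rfl
    · exact (ih₁ h).trans fun _ hx => Or.inr (Or.inl hx)
    · exact (ih₂ h).trans fun _ hx => Or.inr (Or.inr hx)
  | box n φ ih =>
    rcases h with rfl | h
    · exact subset_rfl
    · exact (ih h).trans (Set.subset_insert _ _)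

theorem exists_founded_not_mem {φ : Formula} (h : ¬ Provable φ) : ∃ t ∈ Founded, φ ∉ t := by
  obtain ⟨w, hw, -, hφ⟩ := exists_isMax (mt Der.provable h)
  refine ⟨realization (subformulas φ) w, realization_mem_founded w, fun hφ' => hφ ?_⟩
  refine (mem_realization_iff (fun i ψ hψ => ?_) (subformulas_finite φ) (fun a b hab => ⟨?_, ?_⟩)
    hw (self_mem_subformulas φ)).1 hφ'
  · exact subformulas_subset hψ (Or.inr (self_mem_subformulas ψ))
  · exact subformulas_subset hab (Or.inr (Or.inl (self_mem_subformulas a)))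
  · exact subformulas_subset hab (Or.inr (Or.inr (self_mem_subformulas b)))

/-! ### Derived sets in scattered spaces -/

theorem mem_derivedSet_iff {X : Type*} {τ : TopologicalSpace X} {x : X} {A : Set X} :
    x ∈ @derivedSet X τ A ↔ ∀ U, IsOpen[τ] U → x ∈ U → ∃ y ∈ U, y ≠ x ∧ y ∈ A := by
  rw [mem_derivedSet, accPt_iff_nhds]
  constructor
  · intro h U hU hx
    obtain ⟨y, hy, hne⟩ := h U (hU.mem_nhds hx)
    exact ⟨y, hy.1, hne, hy.2⟩
  · intro h N hN
    obtain ⟨U, hUN, hU, hx⟩ := mem_nhds_iff.1 hN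
    obtain ⟨y, hy, hne, hA⟩ := h U hU hx
    exact ⟨y, ⟨hUN hy, hA⟩, hne⟩

/-- Without T1 this is not automatic. Otherwise isolate a point of `w` together with the limit
points of `A` in a neighborhood whose only possible point of `A` is `w`. -/
theorem IsScattered.derivedSet_derivedSet_subset {X : Type*} {τ : TopologicalSpace X}
    (hτ : IsScattered τ) (A : Set X) :
    @derivedSet X τ (@derivedSet X τ A) ⊆ @derivedSet X τ A := by
  intro w hw
  by_contra hn
  rw [mem_derivedSet_iff] at hn hw
  push Not at hn
  obtain ⟨N, hN, hwN, hNA⟩ := hn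
  obtain ⟨x, hx, O, hO, hOx⟩ := hτ (insert w (N ∩ @derivedSet X τ A)) (Set.insert_nonempty _ _)
  have hxO : x ∈ O := (hOx.symm.subset rfl).1
  by_cases hxw : x = w
  · subst hxw
    obtain ⟨z, hz, hzx, hzA⟩ := hw (O ∩ N) (@IsOpen.inter _ τ _ _ hO hN) ⟨hxO, hwN⟩
    exact hzx (hOx.subset ⟨hz.1, Or.inr ⟨hz.2, hzA⟩⟩)
  · obtain ⟨hxN, hxA⟩ := hx.resolve_left hxw
    obtain ⟨y, hy, hyx, hyA⟩ := mem_derivedSet_iff.1 hxA (O ∩ N)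
      (@IsOpen.inter _ τ _ _ hO hN) ⟨hxO, hxN⟩
    have hyw : y = w := by
      by_contra hyw
      exact hNA y hy.2 hyw hyA
    exact hyx (hOx.subset ⟨hy.1, Or.inl hyw⟩)

theorem IsScattered.mono {X : Type*} {τ σ : TopologicalSpace X} (h : τ ≤ σ)
    (hσ : IsScattered σ) : IsScattered τ := fun A hA => by
  obtain ⟨x, hx, U, hU, hUA⟩ := hσ A hA
  exact ⟨x, hx, U, h U hU, hUA⟩

/-! ### Soundness -/

theorem IsGLPSpace.isOpen_mono {X : Type*} {τ : ℕ → TopologicalSpace X} (h : IsGLPSpace τ)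
    {m n : ℕ} (hmn : m ≤ n) {U : Set X} (hU : IsOpen[τ m] U) : IsOpen[τ n] U := by
  induction hmn with
  | refl => exact hU
  | step _ ih => exact h.increasing _ _ ih

theorem mem_value_box {X : Type*} {τ : ℕ → TopologicalSpace X} {v : ℕ → Set X} {n : ℕ}
    {φ : Formula} {x : X} : x ∈ value (derivedOps τ) v (box n φ) ↔
      ∃ U, IsOpen[τ n] U ∧ x ∈ U ∧ ∀ y ∈ U, y ≠ x → y ∈ value (derivedOps τ) v φ := by
  rw [value, derivedOps, Set.mem_compl_iff, mem_derivedSet_iff]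
  push Not
  simp only [Set.mem_compl_iff, not_not]

theorem mem_value_imp {X : Type*} {δ : ℕ → Set X → Set X} {v : ℕ → Set X} {φ ψ : Formula}
    {x : X} : x ∈ value δ v (imp φ ψ) ↔ (x ∈ value δ v φ → x ∈ value δ v ψ) := by
  rw [value, Set.mem_union, Set.mem_compl_iff, imp_iff_not_or]

theorem propTruth_value {X : Type*} {δ : ℕ → Set X → Set X} {v : ℕ → Set X} (x : X)
    (φ : Formula) : propTruth (fun ψ => x ∈ value δ v ψ) φ ↔ x ∈ value δ v φ := by
  induction φ with
  | var p => rfl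
  | bot => rfl
  | imp φ ψ ih₁ ih₂ => rw [mem_value_imp, ← ih₁, ← ih₂]; rfl
  | box n φ => rfl

theorem Provable.valid {φ : Formula} (h : Provable φ) {X : Type*} {τ : ℕ → TopologicalSpace X}
    (hτ : IsGLPSpace τ) : Valid (derivedOps τ) φ := by
  intro v
  rw [Set.eq_univ_iff_forall]
  induction h with
  | taut φ h => exact fun x => (propTruth_value x φ).1 (h _)
  | distrib n φ ψ =>
    intro x
    simp only [mem_value_imp, mem_value_box]
    rintro ⟨U, hU, hxU, h₁⟩ ⟨V, hV, hxV, h₂⟩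
    exact ⟨U ∩ V, @IsOpen.inter _ (τ n) _ _ hU hV, ⟨hxU, hxV⟩,
      fun y hy hne => h₁ y hy.1 hne (h₂ y hy.2 hne)⟩
  | loeb n φ =>
    intro x
    rw [mem_value_imp, mem_value_box]
    rintro ⟨U, hU, hxU, h⟩
    by_contra hx
    -- An isolated point of this set would satisfy `[n]φ`, which no point of it does.
    have limit : ∀ y ∈ insert x {y | y ∈ U ∧ y ∉ value (derivedOps τ) v φ},
        y ∉ value (derivedOps τ) v (box n φ) := by
      intro y hy hbox
      by_cases hyx : y = x
      · exact hx (hyx ▸ hbox)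
      · have hy := hy.resolve_left hyx
        exact hy.2 (mem_value_imp.1 (h y hy.1 hyx) hbox)
    obtain ⟨y, hy, O, hO, hOy⟩ := hτ.scattered n
      (insert x {y | y ∈ U ∧ y ∉ value (derivedOps τ) v φ}) (Set.insert_nonempty _ _)
    have hyU : y ∈ U := by
      rcases hy with rfl | hy
      · exact hxU
      · exact hy.1
    refine limit y hy (mem_value_box.2 ⟨O ∩ U, @IsOpen.inter _ (τ n) _ _ hO hU,
      ⟨(hOy.symm.subset rfl).1, hyU⟩, fun z hz hzy => ?_⟩)
    by_contra hzφ
    exact hzy (hOy.subset ⟨hz.1, Or.inr ⟨hz.2, hzφ⟩⟩)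
  | mono m n φ hmn =>
    intro x
    rw [mem_value_imp, mem_value_box, mem_value_box]
    rintro ⟨U, hU, h⟩
    exact ⟨U, hτ.isOpen_mono hmn.le hU, h⟩
  | negIntro m n φ hmn =>
    intro x
    rw [mem_value_imp, mem_value_box, value_dia]
    exact fun hx => ⟨_, hτ.isOpen_mono hmn (hτ.derived_open m _), hx, fun y hy _ => hy⟩
  | mp φ ψ _ _ ih₁ ih₂ => exact fun x => mem_value_imp.1 (ih₂ x) (ih₁ x)
  | nec n φ _ ih =>
    exact fun x => mem_value_box.2
      ⟨Set.univ, @isOpen_univ _ (τ n), Set.mem_univ x, fun y _ _ => ih y⟩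

/-! ### Topologies compatible with a family of maximal consistent sets -/

section Embedding

variable {B : Type u} (th : B → Set Formula)

/-- Every point falsifying `[n]ψ` is a limit of points falsifying `ψ`. -/
def HasLimits (n : ℕ) (τ : TopologicalSpace B) : Prop :=
  ∀ b ψ, box n ψ ∉ th b → ∀ U, IsOpen[τ] U → b ∈ U → ∃ y ∈ U, y ≠ b ∧ ψ ∉ th y

/-- The refinement of `σ` in which `b` has the additional neighborhoods
`{b} ∪ {y | χ, [n]χ ∈ th y}` for `[n]χ ∈ th b`. -/
@[reducible]
def refinement (hth : ∀ b, IsMax (th b)) (n : ℕ) (σ : TopologicalSpace B) :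
    TopologicalSpace B where
  IsOpen V := ∀ b ∈ V, ∃ U χ, IsOpen[σ] U ∧ b ∈ U ∧ box n χ ∈ th b ∧
    ∀ y ∈ U, χ ∈ th y → box n χ ∈ th y → y ∈ V
  isOpen_univ b _ := ⟨Set.univ, imp bot bot, @isOpen_univ _ σ, Set.mem_univ b,
    (hth b).thm _ (.nec n _ (.taut _ fun _ => id)), fun y _ _ _ => Set.mem_univ y⟩
  isOpen_inter V₁ V₂ h₁ h₂ b hb := by
    obtain ⟨U₁, χ₁, hU₁, hb₁, hχ₁, hy₁⟩ := h₁ b hb.1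
    obtain ⟨U₂, χ₂, hU₂, hb₂, hχ₂, hy₂⟩ := h₂ b hb.2
    refine ⟨U₁ ∩ U₂, Formula.and χ₁ χ₂, @IsOpen.inter _ σ _ _ hU₁ hU₂, ⟨hb₁, hb₂⟩, ?_,
      fun y hy hχ hbox => ?_⟩
    · refine (hth b).box_mp ((hth b).box_of_entails (fun s hs h => ?_) hχ₁) hχ₂
      exact (hs.imp_iff _ _).2 fun h' => (hs.and_iff _ _).2 ⟨h, h'⟩
    · have hm := hth y
      rw [hm.and_iff] at hχ
      exact ⟨hy₁ y hy.1 hχ.1 (hm.box_of_entails (fun s hs h => ((hs.and_iff _ _).1 h).1) hbox),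
        hy₂ y hy.2 hχ.2 (hm.box_of_entails (fun s hs h => ((hs.and_iff _ _).1 h).2) hbox)⟩
  isOpen_sUnion c hc b hb := by
    obtain ⟨V, hV, hbV⟩ := hb
    obtain ⟨U, χ, hU, hbU, hχ, hy⟩ := hc V hV b hbV
    exact ⟨U, χ, hU, hbU, hχ, fun y h₁ h₂ h₃ => ⟨V, hV, hy y h₁ h₂ h₃⟩⟩

variable {th}

theorem refinement_le (hth : ∀ b, IsMax (th b)) (n : ℕ) (σ : TopologicalSpace B) :
    refinement th hth n σ ≤ σ := fun V hV b hb =>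
  ⟨V, imp bot bot, hV, hb, (hth b).thm _ (.nec n _ (.taut _ fun _ => id)), fun _ hy _ _ => hy⟩

theorem HasLimits.refinement (hth : ∀ b, IsMax (th b)) {n : ℕ} {σ : TopologicalSpace B}
    (h : HasLimits th n σ) : HasLimits th n (refinement th hth n σ) := by
  intro b ψ hψ V hV hb
  obtain ⟨U, χ, hU, hbU, hχ, hy⟩ := hV b hb
  -- The limit property of `σ` is applied to this implication, so that the point found also lies in
  -- the added neighborhood.
  have hn : box n (imp χ (imp (box n χ) ψ)) ∉ th b := fun hc =>
    hψ ((hth b).box_mp ((hth b).box_mp hc hχ) ((hth b).box_box hχ))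
  obtain ⟨y, hyU, hyb, hyψ⟩ := h b _ hn U hU hbU
  rw [(hth y).imp_iff, (hth y).imp_iff] at hyψ
  push Not at hyψ
  exact ⟨y, hy y hyU hyψ.1 hyψ.2.1, hyb, hyψ.2.2⟩

theorem HasLimits.succ (hth : ∀ b, IsMax (th b)) {n : ℕ} {σ : TopologicalSpace B}
    (h : HasLimits th n σ) : HasLimits th (n + 1) σ := fun b ψ hψ =>
  h b ψ fun hc => hψ ((hth b).box_mono n.le_succ hc)

/-- The topology whose base is the union of a nonempty chain of topologies. -/
@[reducible]
def chainTopology (c : Set (TopologicalSpace B)) (hc : IsChain (fun σ τ => τ ≤ σ) c)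
    (hne : c.Nonempty) : TopologicalSpace B where
  IsOpen V := ∀ b ∈ V, ∃ τ ∈ c, ∃ U, IsOpen[τ] U ∧ b ∈ U ∧ U ⊆ V
  isOpen_univ b _ := by
    obtain ⟨τ, hτ⟩ := hne
    exact ⟨τ, hτ, Set.univ, @isOpen_univ _ τ, Set.mem_univ b, subset_rfl⟩
  isOpen_inter V₁ V₂ h₁ h₂ b hb := by
    obtain ⟨τ₁, hτ₁, U₁, hU₁, hb₁, hs₁⟩ := h₁ b hb.1
    obtain ⟨τ₂, hτ₂, U₂, hU₂, hb₂, hs₂⟩ := h₂ b hb.2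
    have : ∃ τ ∈ c, IsOpen[τ] U₁ ∧ IsOpen[τ] U₂ := by
      rcases eq_or_ne τ₁ τ₂ with rfl | hne
      · exact ⟨τ₁, hτ₁, hU₁, hU₂⟩
      rcases hc hτ₁ hτ₂ hne with h | h
      · exact ⟨τ₂, hτ₂, h _ hU₁, hU₂⟩
      · exact ⟨τ₁, hτ₁, hU₁, h _ hU₂⟩
    obtain ⟨τ, hτ, hU₁, hU₂⟩ := this
    exact ⟨τ, hτ, U₁ ∩ U₂, @IsOpen.inter _ τ _ _ hU₁ hU₂, ⟨hb₁, hb₂⟩,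
      Set.inter_subset_inter hs₁ hs₂⟩
  isOpen_sUnion s hs b hb := by
    obtain ⟨V, hV, hbV⟩ := hb
    obtain ⟨τ, hτ, U, hU, hbU, hUV⟩ := hs V hV b hbV
    exact ⟨τ, hτ, U, hU, hbU, hUV.trans (Set.subset_sUnion_of_mem hV)⟩

/-- `τ` has no proper refinement with `HasLimits th n`. -/
def IsLimitMaximal (th : B → Set Formula) (n : ℕ) (τ : TopologicalSpace B) : Prop :=
  HasLimits th n τ ∧ ∀ τ' ≤ τ, HasLimits th n τ' → τ ≤ τ'

/-- The limit property is tested on one basic open set at a time, so it passes to the topology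
generated by a chain. -/
theorem HasLimits.exists_maximal {n : ℕ} {σ : TopologicalSpace B} (hσ : HasLimits th n σ) :
    ∃ τ ≤ σ, IsLimitMaximal th n τ := by
  obtain ⟨⟨m, hmσ, hm⟩, hmax⟩ := exists_maximal_of_chains_bounded
    (α := {τ : TopologicalSpace B // τ ≤ σ ∧ HasLimits th n τ}) (r := fun a b => b.1 ≤ a.1)
    (fun c hc => by
      rcases c.eq_empty_or_nonempty with rfl | hne
      · exact ⟨⟨σ, le_rfl, hσ⟩, fun a ha => ha.elim⟩
      have hc' : IsChain (fun σ τ => τ ≤ σ) (Subtype.val '' c) := by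
        rintro _ ⟨a, ha, rfl⟩ _ ⟨b, hb, rfl⟩ hab
        exact hc ha hb fun h => hab (congrArg _ h)
      have hle : ∀ a ∈ c, chainTopology _ hc' (hne.image _) ≤ a.1 := fun a ha V hV b hb =>
        ⟨a.1, ⟨a, ha, rfl⟩, V, hV, hb, subset_rfl⟩
      refine ⟨⟨chainTopology _ hc' (hne.image _), ?_, ?_⟩, hle⟩
      · obtain ⟨a, ha⟩ := hne
        exact (hle a ha).trans a.2.1
      · intro b ψ hψ V hV hb
        obtain ⟨_, ⟨a, ha, rfl⟩, U, hU, hbU, hUV⟩ := hV b hb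
        obtain ⟨y, hy, h⟩ := a.2.2 b ψ hψ U hU hbU
        exact ⟨y, hUV hy, h⟩)
    (fun h₁ h₂ => le_trans h₂ h₁)
  exact ⟨m, hmσ, hm, fun τ' hle hl => hmax ⟨τ', hle.trans hmσ, hl⟩ hle⟩

/-- The refinement of `τ` that makes `insert b O` a neighborhood of `b`, for an open `O`. -/
@[reducible]
def pointRefinement (τ : TopologicalSpace B) (b : B) (O : Set B) : TopologicalSpace B where
  IsOpen V := ∀ y ∈ V, ∃ U, IsOpen[τ] U ∧ y ∈ U ∧ ∀ z ∈ U, (y = b → z ∈ insert b O) → z ∈ V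
  isOpen_univ y _ := ⟨Set.univ, @isOpen_univ _ τ, Set.mem_univ y, fun z _ _ => Set.mem_univ z⟩
  isOpen_inter V₁ V₂ h₁ h₂ y hy := by
    obtain ⟨U₁, hU₁, hy₁, hs₁⟩ := h₁ y hy.1
    obtain ⟨U₂, hU₂, hy₂, hs₂⟩ := h₂ y hy.2
    exact ⟨U₁ ∩ U₂, @IsOpen.inter _ τ _ _ hU₁ hU₂, ⟨hy₁, hy₂⟩,
      fun z hz h => ⟨hs₁ z hz.1 h, hs₂ z hz.2 h⟩⟩
  isOpen_sUnion s hs y hy := by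
    obtain ⟨V, hV, hyV⟩ := hy
    obtain ⟨U, hU, hyU, hUV⟩ := hs V hV y hyV
    exact ⟨U, hU, hyU, fun z hz h => ⟨V, hV, hUV z hz h⟩⟩

theorem pointRefinement_le (τ : TopologicalSpace B) (b : B) (O : Set B) :
    pointRefinement τ b O ≤ τ := fun V hV _ hy => ⟨V, hV, hy, fun _ hz _ => hz⟩

theorem isOpen_pointRefinement {τ : TopologicalSpace B} {b : B} {O : Set B} (hO : IsOpen[τ] O) :
    IsOpen[pointRefinement τ b O] (insert b O) := by
  intro y hy
  by_cases hyb : y = b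
  · exact ⟨Set.univ, @isOpen_univ _ τ, Set.mem_univ y, fun z _ h => h hyb⟩
  · exact ⟨O, hO, hy.resolve_left hyb, fun z hz _ => Or.inr hz⟩

/-- In a maximal topology the derived sets are generated by the sets `{y | [n]ψ ∉ th y}`. -/
theorem IsLimitMaximal.exists_of_mem_derivedSet {n : ℕ} {τ : TopologicalSpace B}
    (hτ : IsLimitMaximal th n τ) (hs : IsScattered τ) {Y : Set B} {b : B}
    (hb : b ∈ @derivedSet B τ Y) : ∃ U ψ, IsOpen[τ] U ∧ b ∈ U ∧ box n ψ ∉ th b ∧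
      ∀ y ∈ U, box n ψ ∉ th y → y ∈ @derivedSet B τ Y := by
  let O : Set B := (@closure B τ Y)ᶜ
  have hO : IsOpen[τ] O := (@isClosed_closure B τ Y).isOpen_compl
  -- Otherwise maximality makes `insert b O` open in `τ`, a neighborhood of `b` with no point of `Y`
  -- other than possibly `b`.
  have hnot : ¬ HasLimits th n (pointRefinement τ b O) := fun hl => by
    have hop := hτ.2 _ (pointRefinement_le τ b O) hl _ (isOpen_pointRefinement hO)
    obtain ⟨y, hy, hyb, hyY⟩ := mem_derivedSet_iff.1 hb _ hop (Set.mem_insert _ _)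
    exact hy.resolve_left hyb (@subset_closure B τ Y y hyY)
  unfold HasLimits at hnot
  push Not at hnot
  obtain ⟨y, ψ, hyψ, V, hV, hyV, hlim⟩ := hnot
  obtain ⟨U, hU, hyU, hUV⟩ := hV y hyV
  -- Only the neighborhoods of `b` have changed, so the limit property can fail only there.
  have hyb : y = b := by
    by_contra hyb
    obtain ⟨z, hz, hzy, hzψ⟩ := hτ.1 y ψ hyψ U hU hyU
    exact hzψ (hlim z (hUV z hz fun h => (hyb h).elim) hzy)
  subst hyb
  refine ⟨U, ψ, hU, hyU, hyψ, fun w hw hwψ => ?_⟩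
  by_contra hwn
  -- If `w` is a limit of neither `Y` nor its derived set, a punctured neighborhood of `w` lies in
  -- `O`; there `ψ` would both hold and fail somewhere.
  have hwdd := mt (fun h => hs.derivedSet_derivedSet_subset Y h) hwn
  rw [mem_derivedSet_iff] at hwn hwdd
  push Not at hwn hwdd
  obtain ⟨N, hN, hwN, hNY⟩ := hwn
  obtain ⟨N', hN', hwN', hNY'⟩ := hwdd
  obtain ⟨z, hz, hzw, hzψ⟩ := hτ.1 w ψ hwψ (U ∩ (N ∩ N'))
    (@IsOpen.inter _ τ _ _ hU (@IsOpen.inter _ τ _ _ hN hN')) ⟨hw, hwN, hwN'⟩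
  have hzY : z ∉ Y ∪ @derivedSet B τ Y := by
    rintro (h | h)
    · exact hNY z hz.2.1 hzw h
    · exact hNY' z hz.2.2 hzw h
  rw [← @closure_eq_self_union_derivedSet B τ] at hzY
  have hzy : z ≠ y := by
    rintro rfl
    rw [@closure_eq_self_union_derivedSet B τ] at hzY
    exact hzY (Or.inr hb)
  exact hzψ (hlim z (hUV z hz.1 fun _ => Or.inr hzY) hzy)

theorem isOpen_derivedSet_refinement (hth : ∀ b, IsMax (th b)) {n : ℕ} {τ : TopologicalSpace B}
    (hτ : IsLimitMaximal th n τ) (hs : IsScattered τ) (Y : Set B) :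
    IsOpen[refinement th hth (n + 1) τ] (@derivedSet B τ Y) := by
  intro b hb
  obtain ⟨U, ψ, hU, hbU, hψ, hy⟩ := hτ.exists_of_mem_derivedSet hs hb
  exact ⟨U, neg (box n ψ), hU, hbU, (hth b).box_neg_box n.lt_succ_self hψ,
    fun y hyU hyψ _ => hy y hyU (((hth y).neg_iff _).1 hyψ)⟩

theorem mem_derivedSet_iff_of_le_refinement (hth : ∀ b, IsMax (th b)) {n : ℕ}
    {τ σ : TopologicalSpace B} (hle : τ ≤ refinement th hth n σ) (hl : HasLimits th n τ)
    {ψ : Formula} {b : B} : b ∈ @derivedSet B τ {y | ψ ∉ th y} ↔ box n ψ ∉ th b := by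
  rw [mem_derivedSet_iff]
  refine ⟨fun h hψ => ?_, hl b ψ⟩
  have hop : IsOpen[refinement th hth n σ] (insert b {y | ψ ∈ th y ∧ box n ψ ∈ th y}) := by
    intro y hy
    refine ⟨Set.univ, ψ, @isOpen_univ _ σ, Set.mem_univ y, ?_, fun z _ h₁ h₂ => Or.inr ⟨h₁, h₂⟩⟩
    rcases hy with rfl | hy
    · exact hψ
    · exact hy.2
  obtain ⟨y, hy, hyb, hyψ⟩ := h _ (hle _ hop) (Set.mem_insert _ _)
  exact hyψ (hy.resolve_left hyb).1

/-- The topology of initial segments of a rank function. -/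
@[reducible]
def rankTopology (ρ : B → Ordinal.{0}) : TopologicalSpace B where
  IsOpen V := ∀ b ∈ V, ∀ y, ρ y < ρ b → y ∈ V
  isOpen_univ _ _ y _ := Set.mem_univ y
  isOpen_inter _ _ h₁ h₂ b hb y hy := ⟨h₁ b hb.1 y hy, h₂ b hb.2 y hy⟩
  isOpen_sUnion _ hs b := fun ⟨V, hV, hb⟩ y hy => ⟨V, hV, hs V hV b hb y hy⟩

theorem isScattered_rankTopology (ρ : B → Ordinal.{0}) : IsScattered (rankTopology ρ) := by
  intro A hA
  obtain ⟨x, hx, hmin⟩ := (InvImage.wf ρ Ordinal.lt_wf).has_min A hA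
  refine ⟨x, hx, insert x {y | ρ y < ρ x}, ?_, ?_⟩
  · rintro b (rfl | hb) y hy
    · exact Or.inr hy
    · exact Or.inr (hy.trans hb)
  · ext y
    refine ⟨fun ⟨hy, hyA⟩ => hy.resolve_right fun h => hmin y hyA h, ?_⟩
    rintro rfl
    exact ⟨Or.inl rfl, hx⟩

/-- Maximal consistent sets in which failures of `[0]` are witnessed below give a `GLP`-space. -/
theorem exists_isGLPSpace [Nonempty B] (hth : ∀ b, IsMax (th b)) (ρ : B → Ordinal.{0})
    (hρ : ∀ b ψ, box 0 ψ ∉ th b → ∃ y, ρ y < ρ b ∧ ψ ∉ th y) :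
    ∃ τ : ℕ → TopologicalSpace B, IsGLPSpace τ ∧
      ∀ n ψ b, b ∈ derivedOps τ n {y | ψ ∉ th y} ↔ box n ψ ∉ th b := by
  let Next (n : ℕ) (σ τ : TopologicalSpace B) : Prop :=
    τ ≤ refinement th hth n σ ∧ IsLimitMaximal th n τ
  have next_exists : ∀ n σ, HasLimits th n σ → ∃ τ, Next n σ τ := fun n σ h =>
    (h.refinement hth).exists_maximal
  have base : HasLimits th 0 (rankTopology ρ) := fun b ψ hψ U hU hb => by
    obtain ⟨y, hy, hyψ⟩ := hρ b ψ hψ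
    exact ⟨y, hU b hb y hy, fun h => hy.ne (congrArg ρ h), hyψ⟩
  -- A next topology exists only once the previous one has the limit property; `Classical.epsilon`
  -- permits the recursion before that is proved.
  let τ : ℕ → TopologicalSpace B := fun n =>
    n.rec (Classical.epsilon (Next 0 (rankTopology ρ)))
      fun n σ => Classical.epsilon (Next (n + 1) σ)
  have zero : Next 0 (rankTopology ρ) (τ 0) := Classical.epsilon_spec (next_exists _ _ base)
  have succ_of : ∀ n, HasLimits th n (τ n) → Next (n + 1) (τ n) (τ (n + 1)) := fun n h =>
    Classical.epsilon_spec (next_exists _ _ (h.succ hth))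
  have maximal : ∀ n, IsLimitMaximal th n (τ n) := by
    intro n
    induction n with
    | zero => exact zero.2
    | succ n ih => exact (succ_of n ih.1).2
  have succ : ∀ n, τ (n + 1) ≤ refinement th hth (n + 1) (τ n) := fun n =>
    (succ_of n (maximal n).1).1
  have anti : ∀ n, τ (n + 1) ≤ τ n := fun n => (succ n).trans (refinement_le hth _ _)
  have scattered : ∀ n, IsScattered (τ n) := by
    intro n
    induction n with
    | zero => exact (isScattered_rankTopology ρ).mono (zero.1.trans (refinement_le hth _ _))
    | succ n ih => exact ih.mono (anti n)
  refine ⟨τ, ⟨inferInstance, scattered, fun n => anti n, fun n A => succ n _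
    (isOpen_derivedSet_refinement hth (maximal n) (scattered n) A)⟩, fun n ψ b => ?_⟩
  cases n with
  | zero => exact mem_derivedSet_iff_of_le_refinement hth zero.1 zero.2.1
  | succ n => exact mem_derivedSet_iff_of_le_refinement hth (succ n) (maximal (n + 1)).1

theorem mem_value_iff (hth : ∀ b, IsMax (th b)) {δ : ℕ → Set B → Set B}
    (hδ : ∀ n ψ b, b ∈ δ n {y | ψ ∉ th y} ↔ box n ψ ∉ th b) (φ : Formula) (b : B) :
    b ∈ value δ (fun p => {y | var p ∈ th y}) φ ↔ φ ∈ th b := by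
  induction φ generalizing b with
  | var p => rfl
  | bot => exact ⟨False.elim, (hth b).bot⟩
  | imp φ ψ ih₁ ih₂ => rw [mem_value_imp, ih₁, ih₂, (hth b).imp_iff]
  | box n φ ih =>
    have hset : (value δ (fun p => {y | var p ∈ th y}) φ)ᶜ = {y | φ ∉ th y} :=
      Set.ext fun y => not_congr (ih y)
    rw [value, hset, Set.mem_compl_iff, hδ, not_not]

end Embedding

/-! ### Completeness -/

theorem exists_isGLPSpace_not_valid {φ : Formula} (h : ¬ Provable φ) :
    ∃ (X : Type u) (τ : ℕ → TopologicalSpace X), IsGLPSpace τ ∧ ¬ Valid (derivedOps τ) φ := by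
  obtain ⟨t, ht, hφ⟩ := exists_founded_not_mem h
  let B := ULift.{u} Founded
  let th : B → Set Formula := fun b => b.down.1
  -- The rank is the least stage containing the theory; witnesses come from strictly earlier stages.
  let ρ : B → Ordinal.{0} := fun b => sInf {α | th b ∈ Stage α}
  have hth : ∀ b, IsMax (th b) := fun b => Founded.isMax b.down.2
  have : Nonempty B := ⟨⟨⟨t, ht⟩⟩⟩
  obtain ⟨τ, hτ, hδ⟩ := exists_isGLPSpace hth ρ fun b ψ hψ => by
    have hb : th b ∈ Stage (ρ b) := csInf_mem (s := {α | th b ∈ Stage α}) b.down.2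
    obtain ⟨β, hβ, s, hs, -, hψs⟩ := (mem_stage.1 hb).2 0 ψ hψ
    exact ⟨⟨⟨s, β, hs⟩⟩, (csInf_le' (s := {α | s ∈ Stage α}) hs).trans_lt hβ, hψs⟩
  refine ⟨B, τ, hτ, fun hv => hφ ?_⟩
  exact (mem_value_iff hth hδ φ ⟨⟨t, ht⟩⟩).1 (hv _ ▸ Set.mem_univ _)

end GLP

theorem mainTheorem1 :
    (∀ φ : GLP.Formula, ¬ GLP.Provable φ →
      ∃ (X : Type u) (τ : ℕ → TopologicalSpace X),
        GLP.IsGLPSpace τ ∧ ¬ GLP.Valid (GLP.derivedOps τ) φ) ∧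
    GLP.logicOfGLPSpaces.{u} = {φ : GLP.Formula | GLP.Provable φ} := by
  refine ⟨fun φ => GLP.exists_isGLPSpace_not_valid, Set.ext fun φ => ⟨fun h => ?_,
    fun h X τ hτ => GLP.Provable.valid h hτ⟩⟩
  by_contra hn
  obtain ⟨X, τ, hτ, hv⟩ := GLP.exists_isGLPSpace_not_valid.{u} hn
  exact hv (h X τ hτ)
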